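/- For positive integers $n,d$, let $G(n,d)$ be the random multigraph generated by the configuration model: take $n$ nodes with $d$ legs emanating from each node, and take a uniform random perfect matching of the $dn$ legs, each matched pair of legs becoming an edge between their nodes (if $dn$ is odd, first leave out one leg, chosen in an arbitrary, possibly random, way). Let $G(n,d)^{\mathrm{simp}}$ be its underlying simple graph (loops are deleted, parallel edges are merged). Let $\epsilon>0$, let $d_n\ge 1$ be integers with $d_n=O(n^{1-\epsilon})$, and let the random graph $G_n$ have the distribution of $G(n,d_n)^{\mathrm{simp}}$. Then, for any joint distribution of the $G_n$ (that is, for any random graphs $G_n$ with these distributions defined on a common probability space), the following hold almost surely: (0) all degrees in $G_n$ are at most $d_n$, for every $n$ (so that $(G_n,d_n)$ is an admissible sequence); (1) the sequence $(G_n,d_n)$ is $1$-regular: the degree of a uniform random vertex of $G_n$, divided by $d_n$, tends to $1$ in probability as $n\to\infty$, i.e. for every $\delta>0$ the proportion of the vertices $v$ of $G_n$ with $|\deg_{G_n}(v)/d_n-1|>\delta$ tends to $0$; (2) the sequence $(G_n,d_n)$ has large essential girth: for every $k\ge 3$, $$t_{\mathrm{inj}}(C_k,G_n,d_n)=\frac{\mathrm{inj}(C_k,G_n)}{n\,d_n(d_n-1)^{k-2}}\to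 0\qquad(n\to\infty),$$ where $C_k$ is the cycle on $k$ nodes, $\mathrm{inj}(C_k,G_n)$ is the number of injective homomorphisms $C_k\to G_n$, and the quotient is read as $0$ if $d_n=1$ (in which case $\mathrm{inj}(C_k,G_n)=0$). -/

import Mathlib

open MeasureTheory ProbabilityTheory Filter Topology Asymptotics

namespace GraphSeq

section Densities

/-- `(G, d)` is an admissible pair: `d ≥ 1` and all degrees of the finite simple graph `G` are
at most `d`. -/
def Admissible {V : Type*} [Finite V] (G : SimpleGraph V) (d : ℕ) : Prop :=
  1 ≤ d ∧ ∀ v, (G.neighborSet v).ncard ≤ d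

/-- The injective homomorphism density
`t_inj(F, G, d) = inj(F, G) / (v(G) * d * (d - 1) ^ (v(F) - 2))` of a connected graph `F` in an
admissible pair `(G, d)`; it is `1` if `F` is a single point. Here `G.labelledCopyCount F` is the
number of injective homomorphisms `F → G`. (If `d = 1` and `v(F) ≥ 3`, then there is no injective
homomorphism, and the value of the formula is `0`.) -/
noncomputable def injDensity {V W : Type*} [Fintype V] [Fintype W]
    (F : SimpleGraph W) (G : SimpleGraph V) (d : ℕ) : ℝ :=
  if Fintype.card W = 1 then 1
  else (G.labelledCopyCount F : ℝ) /
    ((Fintype.card V : ℝ) * (d : ℝ) * ((d : ℝ) - 1) ^ (Fintype.card W - 2))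

/-- The sequence `(G n, d n)` is `α`-regular: the degree of a uniform random vertex of `G n`,
divided by `d n`, tends to `α` in probability. -/
def IsRegularSeq (α : ℝ) {V : ℕ → Type*} [∀ n, Fintype (V n)]
    (G : ∀ n, SimpleGraph (V n)) (d : ℕ → ℕ) : Prop :=
  ∀ δ : ℝ, 0 < δ →
    Tendsto (fun n ↦
      ({v : V n | δ < |(((G n).neighborSet v).ncard : ℝ) / (d n : ℝ) - α|}.ncard : ℝ) /
        (Fintype.card (V n) : ℝ)) atTop (𝓝 0)

/-- The sequence `(G n, d n)` has large essential girth: `t_inj(C_k, G n, d n) → 0` for every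
`k ≥ 3`. -/
def HasLargeEssentialGirth {V : ℕ → Type*} [∀ n, Fintype (V n)]
    (G : ∀ n, SimpleGraph (V n)) (d : ℕ → ℕ) : Prop :=
  ∀ k : ℕ, 3 ≤ k →
    Tendsto (fun n ↦ injDensity (SimpleGraph.cycleGraph k) (G n) (d n)) atTop (𝓝 0)

end Densities

section ConfigurationModel

/-- The legs: `d` of them emanate from each of the `n` nodes, `(v, i)` being the `i`-th leg
of `v`. -/
abbrev Leg (n d : ℕ) : Type := Fin n × Fin d

/-- The perfect matchings of the legs outside `S`, a matching being encoded by the involution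
that sends each matched leg to its partner and fixes exactly the legs in `S`. -/
def legMatchings (n d : ℕ) (S : Finset (Leg n d)) : Set (Leg n d → Leg n d) :=
  {f | Function.Involutive f ∧ ∀ x, f x = x ↔ x ∈ S}

/-- The law of the random matching of the legs in the configuration model: choose the set `S` of
legs to be left out with law `ν`, and then a uniform random perfect matching of all other legs. -/
noncomputable def configurationLaw (n d : ℕ) (ν : PMF (Finset (Leg n d))) :
    Measure (Leg n d → Leg n d) :=
  ∑ S, ν S • uniformOn (legMatchings n d S)

/-- `ν` is an admissible way of leaving out legs: no leg is left out if the number `n * d` of legs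
is even, and exactly one leg (chosen in any way, possibly at random) if `n * d` is odd. -/
def LeavesOutParity {n d : ℕ} (ν : PMF (Finset (Leg n d))) : Prop :=
  ∀ S ∈ ν.support, S.card = (n * d) % 2

/-- The underlying simple graph of the multigraph given by a matching `f` of the legs. That
multigraph has one edge between the nodes of `x` and `f x` for every matched pair `{x, f x}` of
legs; here loops are discarded and parallel edges are merged, so that distinct nodes `u` and `v`
are adjacent if and only if some leg of `u` is matched with some leg of `v`. -/
def simpleGraphOf {n d : ℕ} (f : Leg n d → Leg n d) : SimpleGraph (Fin n) :=
  SimpleGraph.fromRel fun u v ↦ ∃ i j, f (u, i) = (v, j)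

/-- The law of the simplified configuration model `G(n, d)^simp`, where the legs to be left out
are chosen with law `ν`. -/
noncomputable def simpleConfigurationLaw (n d : ℕ) (ν : PMF (Finset (Leg n d))) :
    Measure (SimpleGraph (Fin n)) :=
  (configurationLaw n d ν).map simpleGraphOf

end ConfigurationModel

end GraphSeq

/-! Loops, parallel edges and cycles of length `k + 1 ≥ 3` all give closed walks of `k + 1` steps on
distinct legs, with `k = 0`, `k = 1` and `k ≥ 2`. There are at most `(nd)^(k+1) d^(k+1)` candidate
walks, and for large `n` each lies in the matching with probability at most `(2/(nd))^(k+1)`. So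
`O(d^(k+1))` walks are expected, while only `δ n d^k` or more of them do harm.

Markov's inequality then gives `O(d/n) = O(n^(-ε))`, which need not be summable, so an `m`-th moment
is used instead. Few walks of a matching meet a bounded set of legs (`card_legCycles_meeting_le`).
Hence a matching with at least `T` walks contains at least `(T - B)^m` ordered `m`-tuples of
disjoint walks, and such tuples are rare by `card_containsPairs_le`. The result is the tail bound
`O((d/n)^m)` of `card_many_legCycles_le`.

For `ε m ≥ 2` this is summable. The first Borel–Cantelli lemma needs no independence, so the joint
distribution is irrelevant. The deterministic links to the graph are
`labelledCopyCount_cycleGraph_le` and `ncard_irregular_le`. -/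

namespace GraphSeq

/-! ### Uniform random matchings: containment probabilities and the moment bound. -/

section Matchings

variable {α : Type*}

/-- All the points that occur in a list of pairs. -/
def pairPoints (p : List (α × α)) : List α := p.map Prod.fst ++ p.map Prod.snd

/-- The function `f` maps `a` to `b` for all pairs `(a, b)` in the list `p`. -/
def ContainsPairs (p : List (α × α)) (f : α → α) : Prop := ∀ e ∈ p, f e.1 = e.2

lemma mem_pairPoints {p : List (α × α)} {x : α} :
    x ∈ pairPoints p ↔ ∃ e ∈ p, x = e.1 ∨ x = e.2 := by
  simp only [pairPoints, List.mem_append, List.mem_map]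
  constructor
  · rintro (⟨e, he, rfl⟩ | ⟨e, he, rfl⟩)
    exacts [⟨e, he, .inl rfl⟩, ⟨e, he, .inr rfl⟩]
  · rintro ⟨e, he, rfl | rfl⟩
    exacts [.inl ⟨e, he, rfl⟩, .inr ⟨e, he, rfl⟩]

lemma length_pairPoints (p : List (α × α)) : (pairPoints p).length = 2 * p.length := by
  simp [pairPoints]; omega

lemma nodup_pairPoints_cons {a b : α} {p : List (α × α)} :
    (pairPoints ((a, b) :: p)).Nodup ↔
      a ≠ b ∧ a ∉ pairPoints p ∧ b ∉ pairPoints p ∧ (pairPoints p).Nodup := by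
  have h : (pairPoints ((a, b) :: p)).Perm (a :: b :: pairPoints p) := by
    simp only [pairPoints, List.map_cons, List.cons_append]
    exact List.Perm.cons _ List.perm_middle
  rw [h.nodup_iff]
  simp only [List.nodup_cons, List.mem_cons, not_or]
  tauto

lemma pairPoints_append_perm (p q : List (α × α)) :
    (pairPoints (p ++ q)).Perm (pairPoints p ++ pairPoints q) := by
  simp only [pairPoints, List.map_append, List.append_assoc]
  refine List.Perm.append_left _ ?_
  rw [← List.append_assoc, ← List.append_assoc]
  exact List.Perm.append_right _ List.perm_append_comm

lemma nodup_pairPoints_append {p q : List (α × α)} (hp : (pairPoints p).Nodup)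
    (hq : (pairPoints q).Nodup) (hpq : (pairPoints p).Disjoint (pairPoints q)) :
    (pairPoints (p ++ q)).Nodup :=
  (pairPoints_append_perm p q).nodup_iff.2 (hp.append hq hpq)

variable [Fintype α] [DecidableEq α]

open Classical in
/-- The perfect matchings of the complement of `S`, encoded by involutions. -/
noncomputable def matchingFinset (S : Finset α) : Finset (α → α) :=
  {f | Function.Involutive f ∧ ∀ x, f x = x ↔ x ∈ S}

lemma mem_matchingFinset {S : Finset α} {f : α → α} :
    f ∈ matchingFinset S ↔ Function.Involutive f ∧ ∀ x, f x = x ↔ x ∈ S := by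
  simp [matchingFinset]

open Classical in
-- Conjugation by the transposition of `b` and `b'` preserves `S` and all pairs of `p`, and injects
-- one set of matchings into the other.
lemma card_containsPairs_le_of_swap {S : Finset α} {p : List (α × α)} {a b b' : α}
    (hab : a ≠ b) (hab' : a ≠ b') (hb : b ∉ S) (hb' : b' ∉ S)
    (hbp : b ∉ pairPoints p) (hbp' : b' ∉ pairPoints p) :
    ((matchingFinset S).filter fun f ↦ ContainsPairs p f ∧ f a = b).card ≤
      ((matchingFinset S).filter fun f ↦ ContainsPairs p f ∧ f a = b').card := by
  set σ := Equiv.swap b b' with hσ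
  have hσσ : ∀ x, σ (σ x) = x := fun x ↦ Equiv.swap_apply_self b b' x
  have hfix : ∀ x, x ≠ b → x ≠ b' → σ x = x := fun x h h' ↦ Equiv.swap_apply_of_ne_of_ne h h'
  have hS : ∀ x, σ x ∈ S ↔ x ∈ S := by
    intro x
    by_cases h : x = b
    · subst h; simp [hσ, hb, hb']
    by_cases h' : x = b'
    · subst h'; simp [hσ, hb, hb']
    rw [hfix x h h']
  refine Finset.card_le_card_of_injOn (fun f x ↦ σ (f (σ x))) ?_ ?_
  · intro f hf
    simp only [Finset.coe_filter, Set.mem_ofPred_eq, mem_matchingFinset] at hf ⊢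
    obtain ⟨⟨hinv, hfS⟩, hp, hfa⟩ := hf
    refine ⟨⟨fun x ↦ by simp [hσσ, hinv _], fun x ↦ ?_⟩, fun e he ↦ ?_, ?_⟩
    · rw [← hS x, ← hfS (σ x)]
      constructor
      · intro h; rw [← hσσ (f (σ x)), h]
      · intro h; rw [h, hσσ]
    · have h1 : σ e.1 = e.1 := hfix _
        (fun h ↦ hbp (mem_pairPoints.2 ⟨e, he, .inl h.symm⟩))
        (fun h ↦ hbp' (mem_pairPoints.2 ⟨e, he, .inl h.symm⟩))
      have h2 : σ e.2 = e.2 := hfix _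
        (fun h ↦ hbp (mem_pairPoints.2 ⟨e, he, .inr h.symm⟩))
        (fun h ↦ hbp' (mem_pairPoints.2 ⟨e, he, .inr h.symm⟩))
      simp [h1, hp e he, h2]
    · rw [hfix a hab hab', hfa, hσ, Equiv.swap_apply_left]
  · intro f _ g _ h
    funext x
    have := congrFun h (σ x)
    simp only [hσσ] at this
    exact σ.injective this

open Classical in
-- Given `p`, the partner `b` of `a` is no likelier than any other admissible partner `b'`, and the
-- events `f a = b'` are disjoint.
lemma card_containsPairs_cons_le {S : Finset α} {p : List (α × α)} {a b : α}
    (hnd : (pairPoints ((a, b) :: p)).Nodup) :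
    ((Fintype.card α : ℝ) - 2 * p.length - 1 - S.card) *
      ((matchingFinset S).filter (ContainsPairs ((a, b) :: p))).card ≤
      ((matchingFinset S).filter (ContainsPairs p)).card := by
  obtain ⟨hab, hap, hbp, -⟩ := nodup_pairPoints_cons.1 hnd
  have hcons : (matchingFinset S).filter (ContainsPairs ((a, b) :: p)) =
      (matchingFinset S).filter fun f ↦ ContainsPairs p f ∧ f a = b := by
    ext f; simp [ContainsPairs]; tauto
  rw [hcons]
  by_cases hb : b ∈ S
  · have : ((matchingFinset S).filter fun f ↦ ContainsPairs p f ∧ f a = b) = ∅ := by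
      ext f
      simp only [Finset.mem_filter, mem_matchingFinset, Finset.notMem_empty, iff_false]
      rintro ⟨⟨hinv, hfS⟩, -, hfa⟩
      have h1 := (hfS b).2 hb
      rw [← hfa, hinv] at h1
      exact hab (h1.trans hfa)
    simp [this]
  -- The possible partners of `a`: at most `|S|` left-out points, `2 * p.length` points of `p` and
  -- `a` itself are excluded.
  set U : Finset α := Finset.univ \ (S ∪ (pairPoints p).toFinset ∪ {a}) with hU
  have hUcard : (Fintype.card α : ℝ) - 2 * p.length - 1 - S.card ≤ U.card := by
    have h1 : Fintype.card α ≤ U.card + (S ∪ (pairPoints p).toFinset ∪ {a}).card := by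
      rw [hU, ← Finset.card_univ]; exact Finset.card_le_card_sdiff_add_card
    have h2 := Finset.card_union_le (S ∪ (pairPoints p).toFinset) {a}
    have h3 := Finset.card_union_le S (pairPoints p).toFinset
    have h4 := (pairPoints p).toFinset_card_le
    rw [length_pairPoints] at h4
    rw [Finset.card_singleton] at h2
    have h5 : Fintype.card α ≤ U.card + S.card + 2 * p.length + 1 := by omega
    have h6 : (Fintype.card α : ℝ) ≤ U.card + S.card + 2 * p.length + 1 := by exact_mod_cast h5
    linarith
  have hsum : U.card * ((matchingFinset S).filter fun f ↦ ContainsPairs p f ∧ f a = b).card ≤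
      ((matchingFinset S).filter (ContainsPairs p)).card := by
    rw [← smul_eq_mul, ← Finset.sum_const]
    calc _ ≤ ∑ b' ∈ U, ((matchingFinset S).filter fun f ↦ ContainsPairs p f ∧ f a = b').card := by
          refine Finset.sum_le_sum fun b' hb' ↦ ?_
          simp only [hU, Finset.mem_sdiff, Finset.mem_univ, true_and, Finset.mem_union, not_or,
            List.mem_toFinset, Finset.mem_singleton] at hb'
          exact card_containsPairs_le_of_swap hab (Ne.symm hb'.2) hb hb'.1.1 hbp hb'.1.2
      _ = (U.biUnion fun b' ↦
          (matchingFinset S).filter fun f ↦ ContainsPairs p f ∧ f a = b').card := by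
          refine (Finset.card_biUnion fun x _ y _ hxy ↦ ?_).symm
          refine Finset.disjoint_left.2 fun f hf hf' ↦ ?_
          exact hxy ((Finset.mem_filter.1 hf).2.2.symm.trans (Finset.mem_filter.1 hf').2.2)
      _ ≤ _ := by
          refine Finset.card_le_card fun f hf ↦ ?_
          simp only [Finset.mem_biUnion, Finset.mem_filter] at hf ⊢
          obtain ⟨_, _, h1, h2, _⟩ := hf
          exact ⟨h1, h2⟩
  calc _ ≤ (U.card : ℝ) *
        ((matchingFinset S).filter fun f ↦ ContainsPairs p f ∧ f a = b).card := by gcongr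
    _ ≤ _ := by exact_mod_cast hsum

open Classical in
/-- A uniform random matching contains a given list of disjoint pairs with probability at most
`q ^ r`, where `r` is the number of pairs. -/
lemma card_containsPairs_le {S : Finset α} (hS : S.card ≤ 1) {K : ℕ} {q : ℝ} (hq : 0 ≤ q)
    (hqK : 1 ≤ q * ((Fintype.card α : ℝ) - 2 * K - 2)) (p : List (α × α))
    (hnd : (pairPoints p).Nodup) (hpK : p.length ≤ K) :
    (((matchingFinset S).filter (ContainsPairs p)).card : ℝ) ≤
      q ^ p.length * (matchingFinset S).card := by
  induction p with
  | nil => simpa using Finset.card_filter_le _ _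
  | cons e p ih =>
    obtain ⟨a, b⟩ := e
    have h1 := ih (nodup_pairPoints_cons.1 hnd).2.2.2 ((Nat.le_succ _).trans hpK)
    have h2 := card_containsPairs_cons_le (S := S) hnd
    set A : ℝ := (((matchingFinset S).filter (ContainsPairs ((a, b) :: p))).card : ℝ)
    have hA : 0 ≤ A := by positivity
    have hS' : (S.card : ℝ) ≤ 1 := by exact_mod_cast hS
    have hp' : (p.length : ℝ) ≤ K := by
      have : p.length ≤ K := (Nat.le_succ _).trans hpK
      exact_mod_cast this
    calc A ≤ q * ((Fintype.card α : ℝ) - 2 * K - 2) * A := le_mul_of_one_le_left hA hqK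
      _ = q * (((Fintype.card α : ℝ) - 2 * K - 2) * A) := by ring
      _ ≤ q * (((Fintype.card α : ℝ) - 2 * p.length - 1 - S.card) * A) := by
          gcongr ?_ * (?_ * _); linarith
      _ ≤ q * (q ^ p.length * (matchingFinset S).card) := mul_le_mul_of_nonneg_left (h2.trans h1) hq
      _ = _ := by rw [List.length_cons, pow_succ]; ring

open Classical in
/-- If each list of at most `K` pairs contained in a matching meets at most `B` of the
configurations that the matching contains, then the number of matchings with at least `T`
configurations is controlled by the number of `m`-tuples of disjoint configurations. -/
lemma card_many_configurations_le {S : Finset α} (hS : S.card ≤ 1) {K : ℕ} {q : ℝ} (hq : 0 ≤ q)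
    (hqK : 1 ≤ q * ((Fintype.card α : ℝ) - 2 * K - 2))
    {ι : Type*} (C : Finset ι) (L : ι → List (α × α)) {k : ℕ} (hk : ∀ c ∈ C, (L c).length = k)
    (hnd : ∀ c ∈ C, (pairPoints (L c)).Nodup) {B T : ℝ} (hBT : B ≤ T)
    (hB : ∀ f ∈ matchingFinset S, ∀ p : List (α × α), ContainsPairs p f → p.length ≤ K →
      ((C.filter fun c ↦ ContainsPairs (L c) f ∧
        ¬ (pairPoints (L c)).Disjoint (pairPoints p)).card : ℝ) ≤ B)
    (m : ℕ) (p : List (α × α)) (hp : (pairPoints p).Nodup) (hpK : p.length + k * m ≤ K) :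
    (((matchingFinset S).filter fun f ↦ ContainsPairs p f ∧
        T ≤ ((C.filter fun c ↦ ContainsPairs (L c) f).card : ℝ)).card : ℝ) * (T - B) ^ m ≤
      (C.card : ℝ) ^ m * q ^ (p.length + k * m) * (matchingFinset S).card := by
  induction m generalizing p with
  | zero =>
    have h := card_containsPairs_le hS hq hqK p hp (by simpa using hpK)
    simp only [pow_zero, mul_one, one_mul, mul_zero, add_zero]
    refine le_trans ?_ h
    gcongr
    intro h; exact h.1
  | succ m ih =>
    set M := matchingFinset S
    let X : (α → α) → ℝ := fun f ↦ ((C.filter fun c ↦ ContainsPairs (L c) f).card : ℝ)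
    set A : List (α × α) → Finset (α → α) := fun p ↦
      M.filter fun f ↦ ContainsPairs p f ∧ T ≤ X f with hA
    change ((A p).card : ℝ) * (T - B) ^ (m + 1) ≤ _
    set C' := C.filter fun c ↦ (pairPoints (L c)).Disjoint (pairPoints p) with hC'
    have hD : 0 ≤ T - B := by linarith
    -- Double counting: each matching in `A p` contains at least `T - B` configurations disjoint
    -- from `p`, and any of these can be appended to `p`. This is why the induction runs over all
    -- `p`.
    have h1 : ((A p).card : ℝ) * (T - B) ≤ ∑ c ∈ C', ((A (L c ++ p)).card : ℝ) := by
      calc ((A p).card : ℝ) * (T - B) = ∑ f ∈ A p, (T - B) := by rw [Finset.sum_const, nsmul_eq_mul]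
        _ ≤ ∑ f ∈ A p, ((C'.filter fun c ↦ ContainsPairs (L c) f).card : ℝ) := by
            refine Finset.sum_le_sum fun f hf ↦ ?_
            obtain ⟨hfM, hfp, hfT⟩ := Finset.mem_filter.1 hf
            have hb := hB f hfM p hfp (by omega)
            have hsplit : (C.filter fun c ↦ ContainsPairs (L c) f).card ≤
                (C'.filter fun c ↦ ContainsPairs (L c) f).card +
                (C.filter fun c ↦ ContainsPairs (L c) f ∧
                  ¬ (pairPoints (L c)).Disjoint (pairPoints p)).card := by
              refine (Finset.card_le_card fun c hc ↦ ?_).trans (Finset.card_union_le _ _)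
              simp only [hC', Finset.mem_union, Finset.mem_filter] at hc ⊢
              tauto
            have hsplit' : X f ≤ ((C'.filter fun c ↦ ContainsPairs (L c) f).card : ℝ) +
                ((C.filter fun c ↦ ContainsPairs (L c) f ∧
                  ¬ (pairPoints (L c)).Disjoint (pairPoints p)).card : ℝ) := by
              rw [← Nat.cast_add]
              exact Nat.cast_le.2 hsplit
            linarith
        _ = ∑ c ∈ C', (((A p).filter fun f ↦ ContainsPairs (L c) f).card : ℝ) := by
            norm_cast
            exact Finset.sum_card_bipartiteAbove_eq_sum_card_bipartiteBelow
              (fun f c ↦ ContainsPairs (L c) f)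
        _ ≤ _ := by
            refine Finset.sum_le_sum fun c _ ↦ ?_
            gcongr
            intro f hf
            simp only [hA, Finset.mem_filter] at hf ⊢
            refine ⟨hf.1.1, fun e he ↦ ?_, hf.1.2.2⟩
            rcases List.mem_append.1 he with he | he
            exacts [hf.2 e he, hf.1.2.1 e he]
    calc ((A p).card : ℝ) * (T - B) ^ (m + 1)
        = ((A p).card : ℝ) * (T - B) * (T - B) ^ m := by ring
      _ ≤ (∑ c ∈ C', ((A (L c ++ p)).card : ℝ)) * (T - B) ^ m := by gcongr
      _ = ∑ c ∈ C', ((A (L c ++ p)).card : ℝ) * (T - B) ^ m := Finset.sum_mul _ _ _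
      _ ≤ ∑ c ∈ C', (C.card : ℝ) ^ m * q ^ (p.length + k * (m + 1)) * M.card := by
          refine Finset.sum_le_sum fun c hc ↦ ?_
          obtain ⟨hcC, hdisj⟩ := Finset.mem_filter.1 hc
          have hlen : (L c ++ p).length + k * m = p.length + k * (m + 1) := by
            rw [List.length_append, hk c hcC]; ring
          have := ih (L c ++ p) (nodup_pairPoints_append (hnd c hcC) hp hdisj) (by omega)
          rwa [hlen] at this
      _ = C'.card * ((C.card : ℝ) ^ m * q ^ (p.length + k * (m + 1)) * M.card) := by simp
      _ ≤ C.card * ((C.card : ℝ) ^ m * q ^ (p.length + k * (m + 1)) * M.card) := by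
          gcongr
          exact Finset.filter_subset _ _
      _ = _ := by ring

end Matchings

end GraphSeq

namespace GraphSeq

/-! ### Closed walks on legs and their tail bound. -/

section LegCycles

variable {n d : ℕ}

open Classical in
/-- The potential closed walks of `k + 1` steps: step `i` is a pair of legs, the second leg of
each step is at the node of the first leg of the next step, and all legs are distinct. -/
noncomputable def legCycles (n d k : ℕ) : Finset (Fin (k + 1) → Leg n d × Leg n d) :=
  {e | (∀ i, (e i).2.1 = (e (i + 1)).1.1) ∧ (pairPoints (List.ofFn e)).Nodup}

open Classical in
/-- The number of closed walks of `k + 1` steps in the multigraph of the matching `f`. -/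
noncomputable def legCycleCount (k : ℕ) (f : Leg n d → Leg n d) : ℕ :=
  ((legCycles n d k).filter fun e ↦ ContainsPairs (List.ofFn e) f).card

lemma nodup_pairPoints_ofFn {α : Type*} {k : ℕ} {e : Fin k → α × α} :
    (pairPoints (List.ofFn e)).Nodup ↔ (Function.Injective fun i ↦ (e i).1) ∧
      (Function.Injective fun i ↦ (e i).2) ∧ ∀ i j, (e i).1 ≠ (e j).2 := by
  rw [pairPoints, List.nodup_append', List.map_ofFn, List.map_ofFn, List.nodup_ofFn,
    List.nodup_ofFn]
  refine and_congr Iff.rfl (and_congr Iff.rfl ?_)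
  simp only [List.Disjoint, List.mem_ofFn, Function.comp]
  constructor
  · intro h i j hij
    exact h ⟨i, rfl⟩ ⟨j, hij.symm⟩
  · rintro h _ ⟨i, rfl⟩ ⟨j, hj⟩
    exact h i j hj.symm

lemma containsPairs_ofFn {α : Type*} {k : ℕ} {e : Fin k → α × α} {f : α → α} :
    ContainsPairs (List.ofFn e) f ↔ ∀ i, f (e i).1 = (e i).2 := by
  simp [ContainsPairs]

/-- The first legs and the slots of the second legs determine the walk, since the node of each
second leg is that of the next first leg. -/
lemma card_legCycles_le (n d k : ℕ) :
    (legCycles n d k).card ≤ (n * d) ^ (k + 1) * d ^ (k + 1) := by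
  have h : Fintype.card ((Fin (k + 1) → Leg n d) × (Fin (k + 1) → Fin d)) =
      (n * d) ^ (k + 1) * d ^ (k + 1) := by simp
  rw [← h, ← Finset.card_univ]
  refine Finset.card_le_card_of_injOn (fun e ↦ (fun i ↦ (e i).1, fun i ↦ (e i).2.2))
    (fun _ _ ↦ Finset.mem_coe.2 (Finset.mem_univ _)) ?_
  intro e he e' he' h
  have he := (Finset.mem_filter.1 he).2.1
  have he' := (Finset.mem_filter.1 he').2.1
  have h1 : ∀ i, (e i).1 = (e' i).1 := congrFun (Prod.ext_iff.1 h).1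
  have h2 : ∀ i, (e i).2.2 = (e' i).2.2 := congrFun (Prod.ext_iff.1 h).2
  funext i
  refine Prod.ext (h1 i) (Prod.ext ?_ (h2 i))
  rw [he, he', h1]

open Classical Fin.CommRing in
/-- A closed walk in a matching is determined by one of its steps and the slots of the other
legs at which it leaves a node. -/
lemma card_walks_through_leg_le (f : Leg n d → Leg n d) (k : ℕ) (i : Fin (k + 1)) (x : Leg n d) :
    ({s : Fin (k + 1) → Leg n d | (∀ j, (f (s j)).1 = (s (j + 1)).1) ∧ s i = x} :
      Finset (Fin (k + 1) → Leg n d)).card ≤ d ^ k := by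
  have h : Fintype.card (Fin k → Fin d) = d ^ k := by simp
  rw [← h, ← Finset.card_univ]
  refine Finset.card_le_card_of_injOn (fun s j ↦ (s (i.succAbove j)).2)
    (fun _ _ ↦ Finset.mem_coe.2 (Finset.mem_univ _)) ?_
  intro s hs s' hs' h
  obtain ⟨hs, hsi⟩ := (Finset.mem_filter.1 hs).2
  obtain ⟨hs', hsi'⟩ := (Finset.mem_filter.1 hs').2
  have hslot : ∀ j, (s j).2 = (s' j).2 := by
    intro j
    rcases Fin.eq_self_or_eq_succAbove i j with rfl | ⟨l, rfl⟩
    · rw [hsi, hsi']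
    · exact congrFun h l
  -- Going round from step `i`: the matching gives the node of the next step, and its slot is
  -- prescribed.
  have hind : ∀ j : ℕ, s (i + (j : Fin (k + 1))) = s' (i + (j : Fin (k + 1))) := by
    intro j
    induction j with
    | zero => simp [hsi, hsi']
    | succ j ih =>
      refine Prod.ext ?_ (hslot _)
      rw [Nat.cast_succ, ← add_assoc, ← hs, ← hs', ih]
  funext l
  have := hind (l - i : Fin (k + 1)).val
  simpa using this

open Classical in
-- A walk meeting `p` has a first leg among the at most `2 * K` points of `p`; there are `k + 1`
-- positions for it and at most `d ^ k` ways to complete the walk.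
lemma card_legCycles_meeting_le (k K : ℕ) {f : Leg n d → Leg n d} (hf : Function.Involutive f)
    (p : List (Leg n d × Leg n d)) (hp : ContainsPairs p f) (hpK : p.length ≤ K) :
    ((legCycles n d k).filter fun e ↦ ContainsPairs (List.ofFn e) f ∧
      ¬ (pairPoints (List.ofFn e)).Disjoint (pairPoints p)).card ≤
      (k + 1) * (2 * K) * d ^ k := by
  set W : Fin (k + 1) × Leg n d → Finset (Fin (k + 1) → Leg n d) := fun ix ↦
    {s | (∀ j, (f (s j)).1 = (s (j + 1)).1) ∧ s ix.1 = ix.2} with hW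
  set I : Finset (Fin (k + 1) × Leg n d) := Finset.univ ×ˢ (pairPoints p).toFinset with hI
  -- The points of `p` are closed under `f`, so a walk that meets `p` in a second leg also meets it
  -- in the first leg of that step.
  have hclosed : ∀ x, f x ∈ pairPoints p → x ∈ pairPoints p := by
    intro x hx
    obtain ⟨e, he, h | h⟩ := mem_pairPoints.1 hx
    · refine mem_pairPoints.2 ⟨e, he, .inr ?_⟩
      rw [← hp e he, ← h, hf]
    · refine mem_pairPoints.2 ⟨e, he, .inl ?_⟩
      rw [← hp e he] at h
      exact hf.injective h
  calc _ ≤ (I.biUnion W).card := by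
        refine Finset.card_le_card_of_injOn (fun e i ↦ (e i).1) ?_ ?_
        · intro e he
          obtain ⟨hC, hef, hdisj⟩ := Finset.mem_filter.1 he
          have hC := (Finset.mem_filter.1 hC).2.1
          have hef := containsPairs_ofFn.1 hef
          simp only [List.Disjoint, not_forall] at hdisj
          obtain ⟨x, hxe, hxp, -⟩ := hdisj
          obtain ⟨_, hei, hx⟩ := mem_pairPoints.1 hxe
          obtain ⟨i, rfl⟩ := List.mem_ofFn.1 hei
          have hmem : (e i).1 ∈ pairPoints p := by
            rcases hx with rfl | rfl
            · exact hxp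
            · exact hclosed _ (by rwa [hef])
          rw [Finset.mem_coe, Finset.mem_biUnion]
          refine ⟨(i, (e i).1), by simp [hI, hmem], ?_⟩
          simp [hW, hef, hC]
        · intro e he e' he' h
          have hef := containsPairs_ofFn.1 (Finset.mem_filter.1 he).2.1
          have hef' := containsPairs_ofFn.1 (Finset.mem_filter.1 he').2.1
          funext i
          have hi : (e i).1 = (e' i).1 := congrFun h i
          exact Prod.ext hi (by rw [← hef, ← hef', hi])
    _ ≤ I.card * d ^ k :=
        Finset.card_biUnion_le_card_mul _ _ _ fun ix _ ↦ card_walks_through_leg_le f k ix.1 ix.2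
    _ ≤ _ := by
        have h4 := (pairPoints p).toFinset_card_le
        rw [length_pairPoints] at h4
        rw [hI, Finset.card_product, Finset.card_univ, Fintype.card_fin]
        gcongr
        omega

open Classical in
/-- Tail bound for the number of closed walks of `k + 1` steps in a uniform random matching. -/
lemma card_many_legCycles_le {S : Finset (Leg n d)} (hS : S.card ≤ 1) (hd : 1 ≤ d) (k m : ℕ)
    {δ : ℝ} (hδ : 0 < δ) (hn : 4 * ((k + 1) * m) + 4 ≤ n)
    (hδn : 4 * (k + 1) * ((k + 1) * m) ≤ δ * n) :
    (((matchingFinset S).filter fun f ↦ δ * n * d ^ k ≤ (legCycleCount k f : ℝ)).card : ℝ) ≤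
      (2 ^ (k + 2) * d / (δ * n)) ^ m * (matchingFinset S).card := by
  set K := (k + 1) * m with hK
  set N : ℝ := (n : ℝ) * d with hN
  have hn0 : (0 : ℝ) < n := by
    have : 0 < n := by omega
    exact_mod_cast this
  have hd0 : (0 : ℝ) < d := by exact_mod_cast hd
  have hNpos : 0 < N := by positivity
  have hNK : 4 * (K : ℝ) + 4 ≤ N := by
    have h1 : 4 * K + 4 ≤ n * d := hn.trans (Nat.le_mul_of_pos_right n hd)
    rw [hN]; exact_mod_cast h1
  have hcard : (Fintype.card (Leg n d) : ℝ) = N := by simp [hN]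
  -- As `N ≥ 4 * K + 4`, at least `N / 2` partners always remain, so `q = 2 / N` works.
  have hq : (0 : ℝ) ≤ 2 / N := by positivity
  have hqK : 1 ≤ 2 / N * ((Fintype.card (Leg n d) : ℝ) - 2 * K - 2) := by
    rw [hcard, div_mul_eq_mul_div, le_div_iff₀ hNpos]
    linarith
  set T : ℝ := δ * n * d ^ k with hT
  set B : ℝ := (k + 1) * (2 * K) * d ^ k with hBdef
  have hTpos : 0 < T := by positivity
  -- This is what `hδn` is for: `T - B` may be replaced by `T / 2`.
  have hBT : 2 * B ≤ T := by
    have h : 4 * (k + 1) * (K : ℝ) * d ^ k ≤ δ * n * d ^ k := by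
      rw [hK]; push_cast; gcongr
    rw [hBdef, hT]; linarith
  have hmain := card_many_configurations_le hS hq hqK (legCycles n d k) List.ofFn (k := k + 1)
    (fun _ _ ↦ List.length_ofFn) (fun e he ↦ (Finset.mem_filter.1 he).2.2) (B := B) (T := T)
    (by linarith)
    (fun f hf p hp hpK ↦ by
      have := card_legCycles_meeting_le k K (mem_matchingFinset.1 hf).1 p hp hpK
      rw [hBdef]; exact_mod_cast this) m [] (by simp [pairPoints]) (by simp [hK])
  have hnil : ∀ f : Leg n d → Leg n d, ContainsPairs [] f := fun f e he ↦ by simp at he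
  simp only [hnil, true_and, List.length_nil, zero_add] at hmain
  set A : ℝ := (((matchingFinset S).filter fun f ↦ T ≤ (legCycleCount k f : ℝ)).card : ℝ)
  change A * (T - B) ^ m ≤ _ at hmain
  have hC : ((legCycles n d k).card : ℝ) ≤ N ^ (k + 1) * d ^ (k + 1) := by
    rw [hN]; exact_mod_cast card_legCycles_le n d k
  have h1 : A * (T / 2) ^ m ≤ (2 ^ (k + 1) * d ^ (k + 1)) ^ m * (matchingFinset S).card := by
    calc A * (T / 2) ^ m ≤ A * (T - B) ^ m := by gcongr; linarith
      _ ≤ _ := hmain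
      _ ≤ (N ^ (k + 1) * d ^ (k + 1)) ^ m * (2 / N) ^ ((k + 1) * m) * (matchingFinset S).card := by
          gcongr
      _ = _ := by
          rw [pow_mul, ← mul_pow]
          congr 2
          rw [div_pow]; field_simp
  rw [← le_div_iff₀ (by positivity)] at h1
  refine h1.trans_eq ?_
  rw [mul_div_right_comm, ← div_pow]
  congr 2
  rw [hT]; field_simp; ring

end LegCycles

end GraphSeq

namespace GraphSeq

/-! ### From the matching to the simple graph: cycles. -/

section SimpleGraphOfMatching

variable {n d : ℕ} {f : Leg n d → Leg n d}

lemma simpleGraphOf_adj (hf : Function.Involutive f) {u v : Fin n} :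
    (simpleGraphOf f).Adj u v ↔ u ≠ v ∧ ∃ i, (f (u, i)).1 = v := by
  rw [simpleGraphOf, SimpleGraph.fromRel_adj]
  refine and_congr Iff.rfl ⟨?_, ?_⟩
  · rintro (⟨i, j, h⟩ | ⟨i, j, h⟩)
    · exact ⟨i, by rw [h]⟩
    · exact ⟨j, by rw [← h, hf]⟩
  · rintro ⟨i, rfl⟩
    exact .inl ⟨i, (f (u, i)).2, rfl⟩

lemma ncard_neighborSet_simpleGraphOf_le (hf : Function.Involutive f) (u : Fin n) :
    ((simpleGraphOf f).neighborSet u).ncard ≤ d := by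
  have h : (simpleGraphOf f).neighborSet u ⊆ Set.range fun i ↦ (f (u, i)).1 := by
    intro v hv
    obtain ⟨-, i, hi⟩ := (simpleGraphOf_adj hf).1 hv
    exact ⟨i, hi⟩
  refine (Set.ncard_le_ncard h).trans ?_
  rw [← Set.image_univ]
  refine (Set.ncard_image_le).trans ?_
  simp [Set.ncard_univ]

open Classical in
-- For each edge of the cycle choose a leg realizing it. Recording the start nodes makes the copy
-- recoverable from the walk.
lemma exists_legCycle_of_copy (hf : Function.Involutive f) {k : ℕ} (hk : 2 ≤ k)
    (φ : SimpleGraph.Copy (SimpleGraph.cycleGraph (k + 1)) (simpleGraphOf f)) :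
    ∃ e ∈ (legCycles n d k).filter fun e ↦ ContainsPairs (List.ofFn e) f,
      ∀ i, (e i).1.1 = φ i := by
  have hadj : ∀ i : Fin (k + 1), ∃ j, (f (φ i, j)).1 = φ (i + 1) := by
    intro i
    have h : (SimpleGraph.cycleGraph (k + 1)).Adj i (i + 1) := by
      rw [SimpleGraph.cycleGraph_adj']
      right
      rw [add_sub_cancel_left, Fin.val_one', Nat.mod_eq_of_lt (by omega)]
    exact ((simpleGraphOf_adj hf).1 (φ.toHom.map_adj h)).2
  choose slot hslot using hadj
  -- Here `2 ≤ k` matters: a leg used both to leave and to arrive would make the cycle turn straight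
  -- back.
  have htwo : ∀ j : Fin (k + 1), j + 1 + 1 ≠ j := by
    intro j h
    rw [add_assoc, add_eq_left] at h
    have h2 := congrArg Fin.val h
    rw [Fin.val_add, Fin.val_one', Nat.mod_eq_of_lt (show 1 < k + 1 by omega),
      Nat.mod_eq_of_lt (by omega)] at h2
    simp at h2
  have hinj : Function.Injective φ := φ.injective
  refine ⟨fun i ↦ ((φ i, slot i), f (φ i, slot i)), ?_, fun _ ↦ rfl⟩
  rw [Finset.mem_filter, containsPairs_ofFn, legCycles, Finset.mem_filter]
  refine ⟨⟨Finset.mem_univ _, fun i ↦ hslot i, nodup_pairPoints_ofFn.2 ⟨?_, ?_, ?_⟩⟩,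
    fun _ ↦ rfl⟩
  · intro i j h
    exact hinj (Prod.ext_iff.1 h).1
  · intro i j h
    exact hinj (Prod.ext_iff.1 (hf.injective h)).1
  · intro i j h
    change (φ i, slot i) = f (φ j, slot j) at h
    have h1 : i = j + 1 := hinj (by rw [← hslot j, ← h])
    have h2 : i + 1 = j := hinj (by rw [← hslot i, h, hf])
    exact htwo j (by rw [← h1, h2])

lemma labelledCopyCount_eq_natCard {V W : Type*} [Fintype V] [Fintype W] (G : SimpleGraph V)
    (H : SimpleGraph W) : G.labelledCopyCount H = Nat.card (SimpleGraph.Copy H G) := by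
  classical
  rw [Nat.card_eq_fintype_card]
  unfold SimpleGraph.labelledCopyCount
  congr

lemma labelledCopyCount_cycleGraph_le (hf : Function.Involutive f) {k : ℕ} (hk : 2 ≤ k) :
    (simpleGraphOf f).labelledCopyCount (SimpleGraph.cycleGraph (k + 1)) ≤ legCycleCount k f := by
  choose e he hφ using exists_legCycle_of_copy hf hk
  rw [labelledCopyCount_eq_natCard, legCycleCount, ← Nat.card_eq_finsetCard]
  refine Nat.card_le_card_of_injective (fun φ ↦ ⟨e φ, he φ⟩) fun φ ψ h ↦ ?_
  have h' : e φ = e ψ := congrArg Subtype.val h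
  refine DFunLike.ext _ _ fun i ↦ ?_
  rw [← hφ, ← hφ, h']

/-! ### Degree defects, and the density of cycles. -/

open Classical in
/-- The legs that do not contribute to the degree of their node in the simple graph: those
that are left out, those in a loop, and those parallel to an earlier leg. -/
noncomputable def redundantLegs (f : Leg n d → Leg n d) : Finset (Leg n d) :=
  {x | (f x).1 = x.1 ∨ ∃ i < x.2, (f (x.1, i)).1 = (f x).1}

open Classical in
-- The other legs of `u` lead to pairwise distinct neighbours of `u`.
lemma le_ncard_neighborSet_add (hf : Function.Involutive f) (u : Fin n) :
    d ≤ ((simpleGraphOf f).neighborSet u).ncard +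
      ({i | (u, i) ∈ redundantLegs f} : Finset (Fin d)).card := by
  have h1 : (Finset.univ.filter fun i ↦ (u, i) ∉ redundantLegs f).card ≤
      ((simpleGraphOf f).neighborSet u).ncard := by
    rw [← Set.ncard_coe_finset]
    refine Set.ncard_le_ncard_of_injOn (fun i ↦ (f (u, i)).1) ?_ ?_
    · intro i hi
      simp only [redundantLegs, Finset.coe_filter, Finset.mem_univ, true_and, Set.mem_ofPred_eq,
        Finset.mem_filter, not_or] at hi
      exact (simpleGraphOf_adj hf).2 ⟨Ne.symm hi.1, i, rfl⟩
    · intro i hi j hj hij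
      simp only [redundantLegs, Finset.coe_filter, Finset.mem_univ, true_and, Set.mem_ofPred_eq,
        Finset.mem_filter, not_or, not_exists, not_and] at hi hj
      rcases lt_trichotomy i j with h | h | h
      · exact absurd hij (hj.2 i h)
      · exact h
      · exact absurd hij.symm (hi.2 j h)
  have h2 := Finset.card_filter_add_card_filter_not (s := (Finset.univ : Finset (Fin d)))
    (fun i ↦ (u, i) ∈ redundantLegs f)
  rw [Finset.card_univ, Fintype.card_fin] at h2
  omega

open Classical in
lemma card_loops_le (f : Leg n d → Leg n d) :
    ({x | (f x).1 = x.1 ∧ f x ≠ x} : Finset (Leg n d)).card ≤ legCycleCount 0 f := by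
  refine Finset.card_le_card_of_injOn (fun x _ ↦ (x, f x)) ?_ ?_
  · intro x hx
    obtain ⟨-, h1, h2⟩ := Finset.mem_filter.1 hx
    rw [Finset.mem_coe, Finset.mem_filter, containsPairs_ofFn, legCycles, Finset.mem_filter]
    exact ⟨⟨Finset.mem_univ _, fun _ ↦ h1, nodup_pairPoints_ofFn.2
      ⟨fun i j _ ↦ Fin.ext (by omega), fun i j _ ↦ Fin.ext (by omega),
        fun _ _ h ↦ h2 h.symm⟩⟩, fun _ ↦ rfl⟩
  · intro x _ y _ h
    exact congrArg Prod.fst (congrFun h 0)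

open Classical in
-- Leaving along `x` and returning along an earlier parallel leg is a closed walk of two steps whose
-- first entry recovers `x`.
lemma card_parallel_le (hf : Function.Involutive f) :
    ({x | (f x).1 ≠ x.1 ∧ ∃ i < x.2, (f (x.1, i)).1 = (f x).1} : Finset (Leg n d)).card ≤
      legCycleCount 1 f := by
  have hex : ∀ x : Leg n d, ∃ i, (∃ i < x.2, (f (x.1, i)).1 = (f x).1) →
      i < x.2 ∧ (f (x.1, i)).1 = (f x).1 := by
    intro x
    by_cases h : ∃ i < x.2, (f (x.1, i)).1 = (f x).1
    · obtain ⟨i, hi⟩ := h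
      exact ⟨i, fun _ ↦ hi⟩
    · exact ⟨x.2, fun h' ↦ absurd h' h⟩
  choose g hg using hex
  refine Finset.card_le_card_of_injOn
    (fun x ↦ ![(x, f x), (f (x.1, g x), (x.1, g x))]) ?_ ?_
  · intro x hx
    obtain ⟨-, h1, h2⟩ := Finset.mem_filter.1 hx
    obtain ⟨h3, h4⟩ := hg x h2
    have hne : (x.1, g x) ≠ x := fun h ↦ h3.ne (congrArg Prod.snd h)
    have hne1 : f (x.1, g x) ≠ x := fun h ↦ h1 (by rw [← h4, h])
    have hne2 : f x ≠ (x.1, g x) := fun h ↦ h1 (by rw [h])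
    have hne3 : f (x.1, g x) ≠ (x.1, g x) := fun h ↦ h1 (by rw [← h4, h])
    have hne4 : f x ≠ x := fun h ↦ h1 (by rw [h])
    have hne5 : f (x.1, g x) ≠ f x := fun h ↦ hne (hf.injective h)
    rw [Finset.mem_coe, Finset.mem_filter, containsPairs_ofFn, legCycles, Finset.mem_filter]
    refine ⟨⟨Finset.mem_univ _, ?_, nodup_pairPoints_ofFn.2 ⟨?_, ?_, ?_⟩⟩, ?_⟩
    · intro i
      fin_cases i
      · exact h4.symm
      · rfl
    · intro i j h
      fin_cases i <;> fin_cases j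
      · rfl
      · exact absurd h.symm hne1
      · exact absurd h hne1
      · rfl
    · intro i j h
      fin_cases i <;> fin_cases j
      · rfl
      · exact absurd h hne2
      · exact absurd h.symm hne2
      · rfl
    · intro i j
      fin_cases i <;> fin_cases j
      · exact hne4.symm
      · exact hne.symm
      · exact hne5
      · exact hne3
    · intro i
      fin_cases i
      · rfl
      · exact hf _
  · intro x _ y _ h
    exact congrArg Prod.fst (congrFun h 0)

lemma card_redundantLegs_le {S : Finset (Leg n d)} (hf : f ∈ matchingFinset S) :
    (redundantLegs f).card ≤ S.card + legCycleCount 0 f + legCycleCount 1 f := by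
  classical
  obtain ⟨hinv, hfS⟩ := mem_matchingFinset.1 hf
  refine le_trans ?_ (add_le_add (add_le_add le_rfl (card_loops_le f)) (card_parallel_le hinv))
  refine le_trans (Finset.card_le_card ?_) ((Finset.card_union_le _ _).trans
    (Nat.add_le_add_right (Finset.card_union_le _ _) _))
  intro x hx
  have hx := (Finset.mem_filter.1 hx).2
  simp only [Finset.mem_union, Finset.mem_filter, Finset.mem_univ, true_and, ← hfS x]
  tauto

/-- Degrees never exceed `d`, so a deviation is a deficit, bounded by the redundant legs at the
vertex; Markov's inequality for the total deficit finishes. -/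
lemma ncard_irregular_le {S : Finset (Leg n d)} (hS : S.card ≤ 1) (hf : f ∈ matchingFinset S)
    (hd : 1 ≤ d) {δ : ℝ} :
    ({v : Fin n | δ < |(((simpleGraphOf f).neighborSet v).ncard : ℝ) / (d : ℝ) - 1|}.ncard : ℝ) *
      (δ * d) ≤ 1 + legCycleCount 0 f + legCycleCount 1 f := by
  classical
  have hinv := (mem_matchingFinset.1 hf).1
  have hd0 : (0 : ℝ) < d := by exact_mod_cast hd
  set A := {v : Fin n | δ < |(((simpleGraphOf f).neighborSet v).ncard : ℝ) / (d : ℝ) - 1|}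
  set r : Fin n → ℕ := fun v ↦ ({i | (v, i) ∈ redundantLegs f} : Finset (Fin d)).card with hr
  have hA : ∀ v ∈ A.toFinset, δ * d ≤ (r v : ℝ) := by
    intro v hv
    have hv : δ < |(((simpleGraphOf f).neighborSet v).ncard : ℝ) / (d : ℝ) - 1| :=
      (Set.mem_toFinset (s := A)).1 hv
    have h1 : (((simpleGraphOf f).neighborSet v).ncard : ℝ) ≤ d := by
      exact_mod_cast ncard_neighborSet_simpleGraphOf_le hinv v
    have h2 : (d : ℝ) ≤ ((simpleGraphOf f).neighborSet v).ncard + r v := by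
      exact_mod_cast le_ncard_neighborSet_add hinv v
    rw [abs_of_nonpos (by rw [sub_nonpos, div_le_one hd0]; exact h1)] at hv
    have h3 : δ * d < -((((simpleGraphOf f).neighborSet v).ncard : ℝ) / d - 1) * d := by gcongr
    have h4 : -((((simpleGraphOf f).neighborSet v).ncard : ℝ) / d - 1) * d =
        d - ((simpleGraphOf f).neighborSet v).ncard := by field_simp; ring
    linarith
  have hsum : ∑ v, r v = (redundantLegs f).card := by
    rw [Finset.card_eq_sum_card_fiberwise (f := Prod.fst) (t := Finset.univ)
      (fun _ _ ↦ Finset.mem_coe.2 (Finset.mem_univ _))]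
    refine Finset.sum_congr rfl fun v _ ↦ ?_
    refine Finset.card_bij (fun i _ ↦ (v, i)) ?_ ?_ ?_
    · intro i hi
      simpa using hi
    · intro i _ j _ h
      exact (Prod.ext_iff.1 h).2
    · rintro ⟨w, i⟩ hx
      obtain ⟨hx, rfl⟩ := Finset.mem_filter.1 hx
      exact ⟨i, by simpa using hx, rfl⟩
  have hle := card_redundantLegs_le hf
  have hle' : ((redundantLegs f).card : ℝ) ≤ 1 + legCycleCount 0 f + legCycleCount 1 f := by
    have : (redundantLegs f).card ≤ 1 + legCycleCount 0 f + legCycleCount 1 f := by omega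
    exact_mod_cast this
  calc (A.ncard : ℝ) * (δ * d) = ∑ v ∈ A.toFinset, δ * d := by
        rw [Finset.sum_const, nsmul_eq_mul, Set.ncard_eq_toFinset_card']
    _ ≤ ∑ v ∈ A.toFinset, (r v : ℝ) := Finset.sum_le_sum hA
    _ ≤ ∑ v, (r v : ℝ) :=
        Finset.sum_le_sum_of_subset_of_nonneg (Finset.subset_univ _) fun _ _ _ ↦ by positivity
    _ = (redundantLegs f).card := by exact_mod_cast hsum
    _ ≤ _ := hle'

lemma injDensity_cycleGraph_le (hf : Function.Involutive f) (hd : 1 ≤ d) {k : ℕ} (hk : 2 ≤ k)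
    {δ : ℝ} (hδ : 0 < δ) (h : (legCycleCount k f : ℝ) ≤ δ * n * d ^ k) :
    injDensity (SimpleGraph.cycleGraph (k + 1)) (simpleGraphOf f) d ≤ δ * 2 ^ (k - 1) := by
  have hpos : 0 ≤ δ * 2 ^ (k - 1) := by positivity
  have hk1 : k + 1 - 2 = k - 1 := by omega
  rw [injDensity, if_neg (by rw [Fintype.card_fin]; omega), Fintype.card_fin, Fintype.card_fin, hk1]
  rcases Nat.eq_zero_or_pos n with hn | hn
  · subst hn; simpa using hpos
  obtain rfl | hd2 : d = 1 ∨ 2 ≤ d := by omega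
  -- For `d = 1` the denominator vanishes and the quotient is `0` by convention.
  · rw [Nat.cast_one, sub_self, zero_pow (by omega)]; simpa using hpos
  have hn0 : (0 : ℝ) < n := by exact_mod_cast hn
  have hd0 : (2 : ℝ) ≤ d := by exact_mod_cast hd2
  have hd1 : (0 : ℝ) < (d : ℝ) - 1 := by linarith
  rw [div_le_iff₀ (by positivity)]
  have hcount : ((simpleGraphOf f).labelledCopyCount (SimpleGraph.cycleGraph (k + 1)) : ℝ) ≤
      legCycleCount k f := by exact_mod_cast labelledCopyCount_cycleGraph_le hf hk
  calc _ ≤ δ * n * (d : ℝ) ^ k := hcount.trans h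
    _ = δ * n * d * (d : ℝ) ^ (k - 1) := by
        rw [mul_assoc (δ * n), ← pow_succ', Nat.sub_add_cancel (by omega)]
    -- For `d ≥ 2` one has `d ≤ 2 * (d - 1)`, the source of the factor `2 ^ (k - 1)`.
    _ ≤ δ * n * d * (2 * ((d : ℝ) - 1)) ^ (k - 1) := by gcongr; linarith
    _ = _ := by rw [mul_pow]; ring

end SimpleGraphOfMatching

end GraphSeq

namespace GraphSeq

/-! ### Transfer to the law of the graphs and Borel–Cantelli. -/

section Probability

instance simpleGraphFinDiscrete (n : ℕ) : DiscreteMeasurableSpace (SimpleGraph (Fin n)) := by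
  have : MeasurableSingletonClass (SimpleGraph (Fin n)) := by
    refine ⟨fun g ↦ ⟨{g.Adj}, MeasurableSet.singleton _, ?_⟩⟩
    ext h
    simp [SimpleGraph.adj_inj]
  infer_instance

lemma legMatchings_eq_coe {n d : ℕ} (S : Finset (Leg n d)) :
    legMatchings n d S = (matchingFinset S : Set (Leg n d → Leg n d)) := by
  ext f
  simp [legMatchings, mem_matchingFinset]

open Classical in
lemma uniformOn_legMatchings_le {n d : ℕ} {S : Finset (Leg n d)} {A : Set (Leg n d → Leg n d)}
    {b : ℝ} (hb : 0 ≤ b)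
    (h : (((matchingFinset S).filter (· ∈ A)).card : ℝ) ≤ b * (matchingFinset S).card) :
    uniformOn (legMatchings n d S) A ≤ ENNReal.ofReal b := by
  have hA : uniformOn (legMatchings n d S) A =
      uniformOn (matchingFinset S : Set (Leg n d → Leg n d))
        ((matchingFinset S).filter (· ∈ A) : Finset (Leg n d → Leg n d)) := by
    rw [legMatchings_eq_coe, ← uniformOn_inter_self (Finset.finite_toSet _)]
    congr 1
    ext f; simp
  rw [hA, uniformOn_apply_finset, Finset.inter_eq_right.2 (Finset.filter_subset _ _)]
  refine ENNReal.div_le_of_le_mul ?_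
  rw [← ENNReal.ofReal_natCast, ← ENNReal.ofReal_natCast, ← ENNReal.ofReal_mul hb]
  exact ENNReal.ofReal_le_ofReal h

open Classical in
lemma simpleConfigurationLaw_le {n d : ℕ} {ν : PMF (Finset (Leg n d))} (hν : LeavesOutParity ν)
    {A : Set (SimpleGraph (Fin n))} {b : ℝ} (hb : 0 ≤ b)
    (h : ∀ S : Finset (Leg n d), S.card ≤ 1 →
      (((matchingFinset S).filter fun f ↦ simpleGraphOf f ∈ A).card : ℝ) ≤
        b * (matchingFinset S).card) :
    simpleConfigurationLaw n d ν A ≤ ENNReal.ofReal b := by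
  rw [simpleConfigurationLaw, Measure.map_apply (Measurable.of_discrete) (MeasurableSet.of_discrete),
    configurationLaw, Measure.finsetSum_apply]
  calc _ ≤ ∑ S, ν S * ENNReal.ofReal b := by
        refine Finset.sum_le_sum fun S _ ↦ ?_
        rw [Measure.smul_apply, smul_eq_mul]
        by_cases hS : ν S = 0
        · simp [hS]
        have hcard : S.card ≤ 1 := by
          have := hν S ((PMF.mem_support_iff _ _).2 hS)
          omega
        gcongr
        exact uniformOn_legMatchings_le hb (h S hcard)
    _ = _ := by
        have h1 : ∑ S, ν S = 1 := by rw [← PMF.tsum_coe ν, tsum_fintype]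
        rw [← Finset.sum_mul, h1, one_mul]

variable {ε : ℝ} {d : ℕ → ℕ} {ν : ∀ n, PMF (Finset (Leg n (d n)))}
  {Ω : Type*} [MeasurableSpace Ω] {P : Measure Ω}
  {G : ∀ n, Ω → SimpleGraph (Fin n)}

lemma summable_of_isBigO_rpow_one_sub {m : ℕ} (hm : 2 ≤ ε * m)
    (hd : (fun n : ℕ ↦ (d n : ℝ)) =O[atTop] (fun n : ℕ ↦ (n : ℝ) ^ (1 - ε))) (c δ : ℝ) :
    Summable fun n : ℕ ↦ (c * d n / (δ * n)) ^ m := by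
  have hO : (fun n : ℕ ↦ (c * d n / (δ * n)) ^ m) =O[atTop]
      fun n : ℕ ↦ ((n : ℝ) ^ (1 - ε) * (n : ℝ)⁻¹) ^ m := by
    refine IsBigO.pow ?_ m
    have h1 : (fun n : ℕ ↦ c * d n / (δ * n)) = fun n : ℕ ↦ (c / δ) * (d n * (n : ℝ)⁻¹) := by
      funext n; rw [mul_div_mul_comm, div_eq_mul_inv (d n : ℝ)]
    rw [h1]
    exact (hd.mul (isBigO_refl _ _)).const_mul_left _
  refine summable_of_isBigO_nat (Real.summable_nat_rpow.2 (show -(ε * m) < -1 by linarith))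
    (hO.trans (EventuallyEq.isBigO ?_))
  filter_upwards [eventually_ge_atTop 1] with n hn
  have hn0 : (0 : ℝ) < n := by exact_mod_cast hn
  rw [← Real.rpow_neg_one, ← Real.rpow_add hn0, ← Real.rpow_natCast, ← Real.rpow_mul hn0.le]
  congr 1; ring

/-- The degree bound holds for every matching, but `G n` is known only through its law; hence a null
event, from the bound with `b = 0`. -/
lemma ae_admissible (hd_pos : ∀ n, 1 ≤ d n) (hν : ∀ n, LeavesOutParity (ν n))
    (hG : ∀ n, HasLaw (G n) (simpleConfigurationLaw n (d n) (ν n)) P) :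
    ∀ᵐ ω ∂P, ∀ n, Admissible (G n ω) (d n) := by
  classical
  rw [ae_all_iff]
  intro n
  rw [ae_iff, (hG n).measure_eq (p := fun g ↦ ¬ Admissible g (d n)) MeasurableSet.of_discrete]
  rw [← nonpos_iff_eq_zero, ← ENNReal.ofReal_zero]
  refine simpleConfigurationLaw_le (hν n) le_rfl fun S _ ↦ ?_
  refine le_of_eq ?_
  rw [zero_mul, Nat.cast_eq_zero, Finset.card_eq_zero]
  refine Finset.eq_empty_of_forall_notMem fun f hf ↦ ?_
  obtain ⟨hf, hbad⟩ := (@Finset.mem_filter _ _ (_) _ _).1 hf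
  exact hbad ⟨hd_pos n, ncard_neighborSet_simpleGraphOf_le (mem_matchingFinset.1 hf).1⟩

variable [IsProbabilityMeasure P]

/-- Borel--Cantelli for the simplified configuration model: graph properties that force many
closed walks of `k + 1` or of `l + 1` steps almost surely fail eventually. -/
lemma ae_eventually_notMem_of_many_legCycles (hε : 0 < ε) (hd_pos : ∀ n, 1 ≤ d n)
    (hd : (fun n : ℕ ↦ (d n : ℝ)) =O[atTop] (fun n : ℕ ↦ (n : ℝ) ^ (1 - ε)))
    (hν : ∀ n, LeavesOutParity (ν n))
    (hG : ∀ n, HasLaw (G n) (simpleConfigurationLaw n (d n) (ν n)) P)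
    (k l : ℕ) {δ : ℝ} (hδ : 0 < δ) (A : ∀ n, Set (SimpleGraph (Fin n)))
    (hA : ∀ n, ∀ S : Finset (Leg n (d n)), S.card ≤ 1 → ∀ f ∈ matchingFinset S,
      simpleGraphOf f ∈ A n → δ * n * (d n : ℝ) ^ k ≤ legCycleCount k f ∨
        δ * n * (d n : ℝ) ^ l ≤ legCycleCount l f) :
    ∀ᵐ ω ∂P, ∀ᶠ n in atTop, G n ω ∉ A n := by
  classical
  obtain ⟨m, hm⟩ := exists_nat_ge (2 / ε)
  rw [div_le_iff₀' hε] at hm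
  set b : ℕ → ℝ := fun n ↦ (2 ^ (k + 2) * d n / (δ * n)) ^ m + (2 ^ (l + 2) * d n / (δ * n)) ^ m
    with hb
  have hbsum : Summable b :=
    (summable_of_isBigO_rpow_one_sub hm hd _ _).add (summable_of_isBigO_rpow_one_sub hm hd _ _)
  have hb0 : ∀ n, 0 ≤ b n := fun n ↦ by positivity
  have hlarge : ∀ c : ℝ, ∀ᶠ n : ℕ in atTop, c ≤ δ * n := fun c ↦
    (tendsto_natCast_atTop_atTop.const_mul_atTop hδ).eventually_ge_atTop c
  have hbound : ∀ᶠ n : ℕ in atTop, P {ω | G n ω ∈ A n} ≤ ENNReal.ofReal (b n) := by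
    filter_upwards [eventually_ge_atTop (4 * ((k + 1) * m) + 4),
      eventually_ge_atTop (4 * ((l + 1) * m) + 4), hlarge (4 * (k + 1) * ((k + 1) * m)),
      hlarge (4 * (l + 1) * ((l + 1) * m))] with n h1 h2 h3 h4
    rw [(hG n).measure_eq (p := (· ∈ A n)) MeasurableSet.of_discrete]
    refine simpleConfigurationLaw_le (hν n) (hb0 n) fun S hS ↦ ?_
    have hk := card_many_legCycles_le hS (hd_pos n) k m hδ h1 h3
    have hl := card_many_legCycles_le hS (hd_pos n) l m hδ h2 h4
    rw [hb, add_mul]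
    refine le_trans ?_ (add_le_add hk hl)
    rw [← Nat.cast_add]
    refine Nat.cast_le.2 ((Finset.card_le_card fun f hf ↦ ?_).trans (Finset.card_union_le _ _))
    obtain ⟨hfM, hfA⟩ := Finset.mem_filter.1 hf
    simp only [Finset.mem_union, Finset.mem_filter]
    exact (hA n S hS f hfM hfA).imp (⟨hfM, ·⟩) (⟨hfM, ·⟩)
  have hsum : Summable fun n ↦ P.real {ω | G n ω ∈ A n} := by
    refine summable_of_isBigO_nat hbsum (IsBigO.of_bound 1 ?_)
    filter_upwards [hbound] with n hn
    rw [one_mul, Real.norm_of_nonneg measureReal_nonneg, Real.norm_of_nonneg (hb0 n)]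
    exact ENNReal.toReal_le_of_le_ofReal (hb0 n) hn
  have htsum : ∑' n, P {ω | G n ω ∈ A n} ≠ ⊤ := by
    have := hsum.tsum_ofReal_ne_top
    simpa only [ofReal_measureReal (measure_ne_top _ _)] using this
  exact ae_eventually_notMem htsum

lemma ae_isRegularSeq (hε : 0 < ε) (hd_pos : ∀ n, 1 ≤ d n)
    (hd : (fun n : ℕ ↦ (d n : ℝ)) =O[atTop] (fun n : ℕ ↦ (n : ℝ) ^ (1 - ε)))
    (hν : ∀ n, LeavesOutParity (ν n))
    (hG : ∀ n, HasLaw (G n) (simpleConfigurationLaw n (d n) (ν n)) P) :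
    ∀ᵐ ω ∂P, IsRegularSeq 1 (fun n ↦ G n ω) d := by
  set ρ : ∀ n, SimpleGraph (Fin n) → ℝ → ℝ := fun n g δ ↦
    ({v : Fin n | δ < |((g.neighborSet v).ncard : ℝ) / (d n : ℝ) - 1|}.ncard : ℝ) /
      (Fintype.card (Fin n) : ℝ) with hρ
  have hρ_anti : ∀ n g δ δ', δ ≤ δ' → ρ n g δ' ≤ ρ n g δ := by
    intro n g δ δ' h
    have := Set.ncard_le_ncard (s := {v : Fin n | δ' < |((g.neighborSet v).ncard : ℝ) / (d n) - 1|})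
      (t := {v : Fin n | δ < |((g.neighborSet v).ncard : ℝ) / (d n) - 1|})
      (fun v hv ↦ lt_of_le_of_lt h hv)
    simp only [hρ]
    gcongr
  have key : ∀ δ : ℝ, 0 < δ → ∀ᵐ ω ∂P, ∀ᶠ n in atTop, ρ n (G n ω) δ ≤ δ := by
    intro δ hδ
    -- More than `δ * n` bad vertices force a total deficit above `δ ^ 2 * n * d`. The left-out leg,
    -- the loops and the parallel legs each account for at most a third of it, the left-out leg
    -- because `1 ≤ η * n`.
    set η := δ ^ 2 / 3 with hη
    have hη0 : 0 < η := by positivity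
    have h := ae_eventually_notMem_of_many_legCycles hε hd_pos hd hν hG 0 1 hη0
      (fun n ↦ {g | 1 ≤ η * n ∧ δ < ρ n g δ}) ?_
    · filter_upwards [h] with ω hω
      filter_upwards [hω, (tendsto_natCast_atTop_atTop.const_mul_atTop hη0).eventually_ge_atTop 1]
        with n hn hn1
      by_contra hlt
      exact hn ⟨hn1, not_le.1 hlt⟩
    · rintro n S hS f hf ⟨hn1, hlt⟩
      by_contra! hcon
      obtain ⟨h0, h1⟩ := hcon
      rw [pow_zero, mul_one] at h0
      rw [pow_one] at h1
      have hn0 : (0 : ℝ) < n := by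
        by_contra hneg
        have : (n : ℝ) = 0 := le_antisymm (not_lt.1 hneg) (Nat.cast_nonneg _)
        rw [this] at hn1; linarith
      have hd1 : (1 : ℝ) ≤ d n := by exact_mod_cast hd_pos n
      have hle := ncard_irregular_le hS hf (hd_pos n) (δ := δ)
      simp only [hρ, Fintype.card_fin] at hlt
      rw [lt_div_iff₀ hn0] at hlt
      have h2 : η * n ≤ η * n * d n := le_mul_of_one_le_right (by positivity) hd1
      have h3 : δ * n * (δ * d n) ≤ 3 * (η * n * d n) := by
        refine (mul_le_mul_of_nonneg_right hlt.le (by positivity)).trans (hle.trans ?_)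
        linarith
      have h4 : δ * n * (δ * d n) = 3 * (η * n * d n) := by rw [hη]; ring
      have h5 := mul_lt_mul_of_pos_right hlt (show 0 < δ * d n by positivity)
      linarith
  -- Only countably many almost sure events can be intersected; monotonicity of `ρ` in `δ` then
  -- gives all `δ`.
  have hall : ∀ᵐ ω ∂P, ∀ j : ℕ, ∀ᶠ n in atTop, ρ n (G n ω) (1 / ((j : ℝ) + 1)) ≤ 1 / ((j : ℝ) + 1) :=
    ae_all_iff.2 fun j ↦ key _ Nat.one_div_pos_of_nat
  filter_upwards [hall] with ω hω δ hδ
  change Tendsto (fun n ↦ ρ n (G n ω) δ) atTop (𝓝 0)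
  rw [Metric.tendsto_nhds]
  intro r hr
  obtain ⟨j, hj⟩ := exists_nat_one_div_lt (lt_min hδ hr)
  filter_upwards [hω j] with n hn
  have h0 : 0 ≤ ρ n (G n ω) δ := by positivity
  rw [Real.dist_0_eq_abs, abs_of_nonneg h0]
  exact (hρ_anti _ _ _ _ (hj.le.trans (min_le_left _ _))).trans_lt
    (hn.trans_lt (hj.trans_le (min_le_right _ _)))

lemma injDensity_nonneg {V W : Type*} [Fintype V] [Fintype W] (F : SimpleGraph W)
    (g : SimpleGraph V) {d : ℕ} (hd : 1 ≤ d) : 0 ≤ injDensity F g d := by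
  have hd1 : (0 : ℝ) ≤ (d : ℝ) - 1 := by
    rw [sub_nonneg]; exact_mod_cast hd
  rw [injDensity]
  split_ifs <;> positivity

lemma ae_hasLargeEssentialGirth (hε : 0 < ε) (hd_pos : ∀ n, 1 ≤ d n)
    (hd : (fun n : ℕ ↦ (d n : ℝ)) =O[atTop] (fun n : ℕ ↦ (n : ℝ) ^ (1 - ε)))
    (hν : ∀ n, LeavesOutParity (ν n))
    (hG : ∀ n, HasLaw (G n) (simpleConfigurationLaw n (d n) (ν n)) P) :
    ∀ᵐ ω ∂P, HasLargeEssentialGirth (fun n ↦ G n ω) d := by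
  have key : ∀ k : ℕ, 2 ≤ k → ∀ δ : ℝ, 0 < δ → ∀ᵐ ω ∂P, ∀ᶠ n in atTop,
      injDensity (SimpleGraph.cycleGraph (k + 1)) (G n ω) (d n) ≤ δ * 2 ^ (k - 1) := by
    intro k hk δ hδ
    -- A single walk length suffices here, so both lengths are taken to be `k`.
    have h := ae_eventually_notMem_of_many_legCycles hε hd_pos hd hν hG k k hδ
      (fun n ↦ {g | δ * 2 ^ (k - 1) < injDensity (SimpleGraph.cycleGraph (k + 1)) g (d n)}) ?_
    · filter_upwards [h] with ω hω
      filter_upwards [hω] with n hn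
      exact not_lt.1 hn
    · intro n S _ f hf hlt
      left
      by_contra! hcon
      exact absurd (injDensity_cycleGraph_le (mem_matchingFinset.1 hf).1 (hd_pos n) hk hδ hcon.le)
        (not_le.2 hlt)
  have hall : ∀ᵐ ω ∂P, ∀ k : ℕ, 2 ≤ k → ∀ j : ℕ, ∀ᶠ n in atTop,
      injDensity (SimpleGraph.cycleGraph (k + 1)) (G n ω) (d n) ≤
        1 / ((j : ℝ) + 1) * 2 ^ (k - 1) := by
    refine ae_all_iff.2 fun k ↦ ?_
    by_cases hk : 2 ≤ k
    · filter_upwards [ae_all_iff.2 fun j : ℕ ↦ key k hk (1 / ((j : ℝ) + 1))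
        Nat.one_div_pos_of_nat] with ω hω _ using hω
    · exact Eventually.of_forall fun ω h ↦ absurd h hk
  filter_upwards [hall] with ω hω k hk
  obtain ⟨k, rfl⟩ : ∃ l, k = l + 1 := ⟨k - 1, by omega⟩
  rw [Metric.tendsto_nhds]
  intro r hr
  have hpow : (0 : ℝ) < 2 ^ (k - 1) := by positivity
  obtain ⟨j, hj⟩ := exists_nat_one_div_lt (div_pos hr hpow)
  rw [lt_div_iff₀ hpow] at hj
  filter_upwards [hω k (by omega) j] with n hn
  rw [Real.dist_0_eq_abs, abs_of_nonneg (injDensity_nonneg _ _ (hd_pos n))]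
  exact hn.trans_lt hj

end Probability

end GraphSeq

theorem mainTheorem11 (ε : ℝ) (hε : 0 < ε) (d : ℕ → ℕ) (hd_pos : ∀ n, 1 ≤ d n)
    (hd : (fun n : ℕ ↦ (d n : ℝ)) =O[atTop] (fun n : ℕ ↦ (n : ℝ) ^ (1 - ε)))
    (ν : ∀ n, PMF (Finset (GraphSeq.Leg n (d n))))
    (hν : ∀ n, GraphSeq.LeavesOutParity (ν n))
    {Ω : Type*} [MeasurableSpace Ω] (P : Measure Ω) [IsProbabilityMeasure P]
    (G : ∀ n, Ω → SimpleGraph (Fin n))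
    (hG : ∀ n, HasLaw (G n) (GraphSeq.simpleConfigurationLaw n (d n) (ν n)) P) :
    ∀ᵐ ω ∂P,
      (∀ n, GraphSeq.Admissible (G n ω) (d n)) ∧
      GraphSeq.IsRegularSeq 1 (fun n ↦ G n ω) d ∧
      GraphSeq.HasLargeEssentialGirth (fun n ↦ G n ω) d := by
  filter_upwards [GraphSeq.ae_admissible hd_pos hν hG,
    GraphSeq.ae_isRegularSeq hε hd_pos hd hν hG,
    GraphSeq.ae_hasLargeEssentialGirth hε hd_pos hd hν hG] with ω h1 h2 h3
  exact ⟨h1, h2, h3⟩
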